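/- **Soundness of D'.EAK with respect to the final coalgebra semantics.** *Language.* Fix a set $\mathsf{AtProp}$ of atomic propositions and a set $\mathsf{Ag}$ of agents. The EAK-formulas $A ::= p \mid \neg A\mid A\vee A\mid \langle a\rangle A\mid\langle\alpha\rangle A$ and the action structures $\alpha=(K,k,(\alpha_a)_{a\in\mathsf{Ag}},Pre_\alpha)$ ($K$ finite, $k\in K$, $\alpha_a\subseteq K\times K$, $Pre_\alpha$ a map from $K$ to EAK-formulas) are defined simultaneously; $Pre(\alpha):=Pre_\alpha(k)$, $\alpha_i$ is $\alpha$ with designated state $i$, and $\alpha a\beta$ means $\beta=\alpha_i$ for some $i$ with $k\,\alpha_a\,i$. Formulas of D'.EAK are built from atoms, $\bot$, $\top$ and constants $1_\alpha$ by $\wedge,\vee,\to,\leftarrow$, the binary connectives $A\rightarrowtail B$ and $B\leftarrowtail A$, the modalities $\langle a\rangle,[a]$ and $\langle\alpha\rangle,[\alpha]$, and their adjoints $\langle \bar a\rangle,[\bar a]$, $\langle\bar\alpha\rangle,[\bar\alpha]$. Structures are built from these formulas, $\mathrm I$ and $\Phi_\alpha$ by $X;Y$, $X>Y$, $X<Y$,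 $\{a\}X$, $\{\bar a\}X$, $\{\alpha\}X$, $\{\bar\alpha\}X$. A sequent $X\vdash Y$ is a pair of structures. *Semantics.* In a Kripke model $M=(W,(R_a)_{a},V)$ EAK-formulas have their usual extensions, with $M,w\Vdash\langle\alpha\rangle A$ iff $M,w\Vdash Pre(\alpha)$ and $M^\alpha,(w,k)\Vdash A$, where the update $M^\alpha$ has domain $\{(w,j)\in W\times K\mid M,w\Vdash Pre_\alpha(j)\}$, relations $(w,i)R^\alpha_a(u,j)$ iff $wR_au$ and $i\,\alpha_a\,j$, and the valuation inherited from $M$. Let $\mathbb Z$ be the final coalgebra of Kripke models, i.e. the disjoint union of all Kripke models modulo bisimilarity. An action $\alpha$ is interpreted by the relation $\alpha_{\mathbb Z}$ on $\mathbb Z$ such that $z\,\alpha_{\mathbb Z}\,z'$ iff there is a pointed model $(M,w)$ with $M,w\Vdash Pre(\alpha)$ such that the unique morphisms $M\to\mathbb Z$ and $M^\alpha\to\mathbb Z$ map $w$ to $z$ and $(w,k)$ to $z'$. D'.EAK-formulas are interpreted as subsets of $\mathbb Z$: propositional connectives classically, with $[\![ B\leftarrow A]\!]=[\![ A\to B]\!]$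 and $[\![ A\rightarrowtail B]\!]=[\![ B\leftarrowtail A]\!]=[\![ B]\!]\setminus[\![ A]\!]$; $\langle a\rangle,[a]$ (resp. $\langle\alpha\rangle,[\alpha]$) as diamond and box of the relation $R_a$ of $\mathbb Z$ (resp. of $\alpha_{\mathbb Z}$), their adjoints as diamond and box of the converse relation; and $[\![ 1_\alpha]\!]_{\mathbb Z}=[\![ Pre(\alpha)]\!]_{\mathbb Z}$. Structures are translated into formulas according to their position, where the left-hand side of a sequent is in precedent and the right-hand side in succedent position, the first argument of $>$ and the second argument of $<$ switch position, and all other arguments keep it. In precedent (resp. succedent) position $\mathrm I$ is read as $\top$ ($\bot$), $;$ as $\wedge$ ($\vee$), $X>Y$ as $X\rightarrowtail Y$ ($X\to Y$), $X<Y$ as $X\leftarrowtail Y$ ($X\leftarrow Y$), and each modal proxy as the corresponding diamond (box). $\Phi_\alpha$ is read as $1_\alpha$ in precedent position; it is not meant to occur in succedent position, and an arbitrary formula may be chosen as its reading there. A sequent $X\vdash Y$ holds in $\mathbb Z$ if $[\![ X]\!]_{\mathbb Z}\subseteq[\![ Y]\!]_{\mathbb Z}$. *Rules of D'.EAK* (written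 premises $/$ conclusion; $//$ means both directions; $A,B$ are formulas, $X,Y,Z,W$ structures). - Propositional structural rules: $p\vdash p$; Cut $X\vdash A,\ A\vdash Y/X\vdash Y$; $X\vdash Y//\mathrm I\vdash Y<X$; $X\vdash Y//X<Y\vdash\mathrm I$; $X\vdash Y//\mathrm I\vdash X>Y$; $X\vdash Y//Y>X\vdash\mathrm I$; $\mathrm I\vdash X/Y\vdash X$; $X\vdash\mathrm I/X\vdash Y$; weakening $X\vdash Z/Y\vdash Z<X$, $X\vdash Z/X<Z\vdash Y$, $X\vdash Z/Y\vdash X>Z$, $X\vdash Z/Z>X\vdash Y$; contraction $X;X\vdash Y/X\vdash Y$, $Y\vdash X;X/Y\vdash X$; exchange $Y;X\vdash Z/X;Y\vdash Z$, $Z\vdash X;Y/Z\vdash Y;X$; associativity $X;(Y;Z)\vdash W/(X;Y);Z\vdash W$, $W\vdash(Z;Y);X/W\vdash Z;(Y;X)$; display postulates $X;Y\vdash Z//X\vdash Z<Y$, $Z\vdash X;Y//Z<Y\vdash X$, $X;Y\vdash Z//Y\vdash X>Z$, $Z\vdash X;Y//X>Z\vdash Y$; Grishin $X>(Y;Z)\vdash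 W//(X>Y);Z\vdash W$, $W\vdash X>(Y;Z)//W\vdash(X>Y);Z$. - Propositional operational rules: $\bot\vdash\mathrm I$; $X\vdash\mathrm I/X\vdash\bot$; $\mathrm I\vdash X/\top\vdash X$; $\mathrm I\vdash\top$; $A;B\vdash Z/A\wedge B\vdash Z$; $X\vdash A,\ Y\vdash B/X;Y\vdash A\wedge B$; $A\vdash X,\ B\vdash Y/A\vee B\vdash X;Y$; $Z\vdash A;B/Z\vdash A\vee B$; $B\vdash Y,\ X\vdash A/B\leftarrow A\vdash Y<X$; $Z\vdash B<A/Z\vdash B\leftarrow A$; $B<A\vdash Z/B\leftarrowtail A\vdash Z$; $Y\vdash B,\ A\vdash X/Y<X\vdash B\leftarrowtail A$; $X\vdash A,\ B\vdash Y/A\to B\vdash X>Y$; $Z\vdash A>B/Z\vdash A\to B$; $A>B\vdash Z/A\rightarrowtail B\vdash Z$; $A\vdash X,\ Y\vdash B/X>Y\vdash A\rightarrowtail B$. - For each modal proxy $\{m\}\in\{\{a\},\{\bar a\},\{\alpha\},\{\bar\alpha\}\}$, with diamond $\langle m\rangle$ and box $[m]$: $\mathrm I\vdash X/\{m\}\mathrm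 I\vdash X$; $X\vdash\mathrm I/X\vdash\{m\}\mathrm I$; $\{m\}Y>\{m\}Z\vdash X/\{m\}(Y>Z)\vdash X$; $Y\vdash\{m\}X>\{m\}Z/Y\vdash\{m\}(X>Z)$; $\{m\}X;\{m\}Y\vdash Z/\{m\}(X;Y)\vdash Z$; $Z\vdash\{m\}Y;\{m\}X/Z\vdash\{m\}(Y;X)$; $\{m\}A\vdash X/\langle m\rangle A\vdash X$; $X\vdash A/\{m\}X\vdash\langle m\rangle A$; $A\vdash X/[m]A\vdash\{m\}X$; $X\vdash\{m\}A/X\vdash[m]A$. Display postulates, for $m=a$ and $m=\alpha$: $\{m\}X\vdash Y//X\vdash\{\bar m\}Y$ and $X\vdash\{m\}Y//\{\bar m\}X\vdash Y$. - Rules for epistemic actions: *atom* $\Gamma p\vdash\Delta p$, where $\Gamma,\Delta$ are finite sequences of proxies $\{\alpha\}$, $\{\bar\alpha\}$; *balance* $X\vdash Y/\{\alpha\}X\vdash\{\alpha\}Y$; *comp* $\{\alpha\}\{\bar\alpha\}X\vdash Y/\Phi_\alpha;X\vdash Y$ and $X\vdash\{\alpha\}\{\bar\alpha\}Y/X\vdash\Phi_\alpha>Y$;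 *reduce'* $\Phi_\alpha;\{\alpha\}X\vdash Y/\{\alpha\}X\vdash Y$ and $Y\vdash\Phi_\alpha>\{\alpha\}X/Y\vdash\{\alpha\}X$; *swap-in'*, for every $\beta$ with $\alpha a\beta$: $\{\alpha\}\{a\}X\vdash Y/\Phi_\alpha;\{a\}\{\beta\}X\vdash Y$ and $Y\vdash\{\alpha\}\{a\}X/Y\vdash\Phi_\alpha>\{a\}\{\beta\}X$; *swap-out'* $(\{a\}\{\beta\}X\vdash Y\mid\alpha a\beta)/\{\alpha\}\{a\}X\vdash Y^{(n)}$ and $(Y\vdash\{a\}\{\beta\}X\mid\alpha a\beta)/Y^{(n)}\vdash\{\alpha\}\{a\}X$, where $n=|\{\beta\mid\alpha a\beta\}|$, $Y^{(n)}=(\cdots(Y;Y);\cdots;Y)$ with $n$ occurrences of $Y$, and $Y^{(0)}=\mathrm I$; $\Phi_\alpha\vdash X/1_\alpha\vdash X$; $\Phi_\alpha\vdash1_\alpha$. **Theorem.** Every rule of D'.EAK is sound with respect to the final coalgebra semantics: for every instance of a rule, if all premises hold in $\mathbb Z$, then the conclusion holds in $\mathbb Z$. Consequently, every sequent derivable in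 D'.EAK holds in $\mathbb Z$. -/

import Mathlib

universe u v w w'

namespace EAK

/-! ## Formulas and action structures of EAK -/

mutual

/-- The formulas `A ::= p | ¬A | A ∨ A | ⟨a⟩A | ⟨α⟩A` of the logic of epistemic actions and
knowledge, over agents `Ag` and atomic propositions `AtProp`. -/
inductive Formula (Ag : Type u) (AtProp : Type v) : Type (max u v)
  | atom (p : AtProp)
  | neg (A : Formula Ag AtProp)
  | or (A B : Formula Ag AtProp)
  | dia (a : Ag) (A : Formula Ag AtProp)
  | act (α : Action Ag AtProp) (A : Formula Ag AtProp)

/-- Action structures `(K, k, (α_a)_a, Pre_α)`, where `K` is the finite set `Fin n`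
(nonempty because it contains the designated state `k`). -/
inductive Action (Ag : Type u) (AtProp : Type v) : Type (max u v)
  | mk (n : ℕ) (k : Fin n) (rel : Ag → Fin n → Fin n → Prop) (pre : Fin n → Formula Ag AtProp)

end

section Models

variable {Ag : Type u} {AtProp : Type v}

namespace Action

/-- The number of action states. -/
def size : Action Ag AtProp → ℕ
  | mk n _ _ _ => n

/-- The designated state `k`. -/
def point : (α : Action Ag AtProp) → Fin α.size
  | mk _ k _ _ => k

/-- The relation `α_a` on action states. -/
def rel : (α : Action Ag AtProp) → Ag → Fin α.size → Fin α.size → Prop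
  | mk _ _ r _ => r

/-- The precondition map `Pre_α`. -/
def preAt : (α : Action Ag AtProp) → Fin α.size → Formula Ag AtProp
  | mk _ _ _ pre => pre

/-- `Pre(α) = Pre_α(k)`. -/
def pre (α : Action Ag AtProp) : Formula Ag AtProp := α.preAt α.point

/-- The action structure `α_i`, which differs from `α` in having `i` as its designated state. -/
def withPoint (α : Action Ag AtProp) (i : Fin α.size) : Action Ag AtProp :=
  mk α.size i α.rel α.preAt

/-- `α a β`: the action `β` is one of the `α_i` with `k α_a i`. -/
def Sees (α : Action Ag AtProp) (a : Ag) (β : Action Ag AtProp) : Prop :=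
  ∃ i, α.rel a α.point i ∧ β = α.withPoint i

end Action

/-! ## Kripke models, updates, satisfaction -/

/-- Kripke models, i.e. coalgebras `W → (𝒫 W)^Ag × 2^AtProp`. The empty model is not excluded,
since an update may be empty. -/
structure Model (Ag : Type u) (AtProp : Type v) where
  W : Type w
  R : Ag → W → W → Prop
  V : AtProp → Set W

/-- The submodel of the `n`-fold coproduct of `M` (with relations `R_a × r_a`) on the pairs
`(x, j)` with `x ∈ S j`. -/
def Model.product (M : Model.{u, v, w} Ag AtProp) {n : ℕ} (r : Ag → Fin n → Fin n → Prop)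
    (S : Fin n → Set M.W) : Model.{u, v, w} Ag AtProp where
  W := {x : M.W × Fin n // x.1 ∈ S x.2}
  R a x y := M.R a x.1.1 y.1.1 ∧ r a x.1.2 y.1.2
  V p := {x | x.1.1 ∈ M.V p}

/-- The extension `⟦A⟧_M` of an EAK-formula in a Kripke model. -/
def Formula.ext : Formula Ag AtProp → (M : Model.{u, v, w} Ag AtProp) → Set M.W
  | .atom p, M => M.V p
  | .neg A, M => (A.ext M)ᶜ
  | .or A B, M => A.ext M ∪ B.ext M
  | .dia a A, M => {x | ∃ y, M.R a x y ∧ y ∈ A.ext M}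
  | .act (.mk _ k r pre) A, M =>
      {x | ∃ h : x ∈ (pre k).ext M,
        (⟨(x, k), h⟩ : (M.product r fun j => (pre j).ext M).W) ∈
          A.ext (M.product r fun j => (pre j).ext M)}

/-- The update `M^α`. -/
def Model.update (M : Model.{u, v, w} Ag AtProp) (α : Action Ag AtProp) :
    Model.{u, v, w} Ag AtProp :=
  M.product α.rel fun j => (α.preAt j).ext M

/-! ## The final coalgebra -/

/-- Bisimulations between Kripke models. -/
structure IsBisimulation (M : Model.{u, v, w} Ag AtProp) (N : Model.{u, v, w'} Ag AtProp)
    (B : M.W → N.W → Prop) : Prop where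
  atom : ∀ x y, B x y → ∀ p, x ∈ M.V p ↔ y ∈ N.V p
  forth : ∀ x y, B x y → ∀ a x', M.R a x x' → ∃ y', N.R a y y' ∧ B x' y'
  back : ∀ x y, B x y → ∀ a y', N.R a y y' → ∃ x', M.R a x x' ∧ B x' y'

/-- Coalgebra morphisms, i.e. p-morphisms. -/
structure IsMorphism (M : Model.{u, v, w} Ag AtProp) (N : Model.{u, v, w'} Ag AtProp)
    (f : M.W → N.W) : Prop where
  atom : ∀ x p, x ∈ M.V p ↔ f x ∈ N.V p
  forth : ∀ x a x', M.R a x x' → N.R a (f x) (f x')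
  back : ∀ x a y, N.R a (f x) y → ∃ x', M.R a x x' ∧ f x' = y

/-- Pointed Kripke models with carrier in `Type w`. -/
abbrev Pointed (Ag : Type u) (AtProp : Type v) := Σ M : Model.{u, v, w} Ag AtProp, M.W

/-- Bisimilarity of pointed models. -/
def Bisimilar (x y : Pointed.{u, v, w} Ag AtProp) : Prop :=
  ∃ B, IsBisimulation x.1 y.1 B ∧ B x.2 y.2

theorem bisimilar_equivalence : Equivalence (Bisimilar (Ag := Ag) (AtProp := AtProp)) where
  refl x := ⟨Eq, ⟨by rintro _ _ rfl p; rfl, by rintro x _ rfl a x' h; exact ⟨x', h, rfl⟩,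
    by rintro x _ rfl a x' h; exact ⟨x', h, rfl⟩⟩, rfl⟩
  symm := by
    rintro x y ⟨B, hB, h⟩
    exact ⟨fun s t => B t s, ⟨fun s t k p => (hB.atom _ _ k p).symm,
      fun s t k => hB.back _ _ k, fun s t k => hB.forth _ _ k⟩, h⟩
  trans := by
    rintro x y z ⟨B, hB, h⟩ ⟨C, hC, k⟩
    refine ⟨fun s t => ∃ m, B s m ∧ C m t, ⟨?_, ?_, ?_⟩, y.2, h, k⟩
    · rintro s t ⟨m, h1, h2⟩ p
      exact (hB.atom _ _ h1 p).trans (hC.atom _ _ h2 p)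
    · rintro s t ⟨m, h1, h2⟩ a s' hs
      obtain ⟨m', hm, h1'⟩ := hB.forth _ _ h1 a s' hs
      obtain ⟨t', ht, h2'⟩ := hC.forth _ _ h2 a m' hm
      exact ⟨t', ht, m', h1', h2'⟩
    · rintro s t ⟨m, h1, h2⟩ a t' ht
      obtain ⟨m', hm, h2'⟩ := hC.back _ _ h2 a t' ht
      obtain ⟨s', hs, h1'⟩ := hB.back _ _ h1 a m' hm
      exact ⟨s', hs, m', h1', h2'⟩

/-- The setoid of bisimilarity. -/
def bisimSetoid (Ag : Type u) (AtProp : Type v) : Setoid (Pointed.{u, v, w} Ag AtProp) :=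
  ⟨Bisimilar, bisimilar_equivalence⟩

/-- The carrier of the final coalgebra: points of Kripke models (with carrier in `Type w`)
up to bisimilarity. -/
def FinalCarrier (Ag : Type u) (AtProp : Type v) : Type (max u v (w + 1)) :=
  Quotient (bisimSetoid.{u, v, w} Ag AtProp)

/-- The map from a Kripke model to the final coalgebra. -/
def beh (M : Model.{u, v, w} Ag AtProp) (x : M.W) : FinalCarrier.{u, v, w} Ag AtProp :=
  Quotient.mk _ ⟨M, x⟩

/-- The final coalgebra `ℤ`: the disjoint union of all Kripke models, quotiented by
bisimilarity. -/
abbrev finalModel (Ag : Type u) (AtProp : Type v) : Model.{u, v, max u v (w + 1)} Ag AtProp where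
  W := FinalCarrier.{u, v, w} Ag AtProp
  R a z z' := ∃ (M : Model.{u, v, w} Ag AtProp) (x x' : M.W),
    M.R a x x' ∧ beh M x = z ∧ beh M x' = z'
  V p := {z | ∃ (M : Model.{u, v, w} Ag AtProp) (x : M.W), x ∈ M.V p ∧ beh M x = z}

theorem beh_eq_iff {M N : Model.{u, v, w} Ag AtProp} {x : M.W} {y : N.W} :
    beh M x = beh N y ↔ Bisimilar (⟨M, x⟩ : Pointed.{u, v, w} Ag AtProp) ⟨N, y⟩ :=
  Quotient.eq (r := bisimSetoid.{u, v, w} Ag AtProp)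

/-- The map `beh M` is a coalgebra morphism. -/
theorem beh_isMorphism (M : Model.{u, v, w} Ag AtProp) :
    IsMorphism M (finalModel.{u, v, w} Ag AtProp) (beh M) where
  atom x p := by
    refine ⟨fun h => ⟨M, x, h, rfl⟩, ?_⟩
    rintro ⟨N, y, hy, h⟩
    obtain ⟨B, hB, hb⟩ := beh_eq_iff.1 h
    exact (hB.atom _ _ hb p).1 hy
  forth x a x' h := ⟨M, x, x', h, rfl, rfl⟩
  back x a z := by
    rintro ⟨N, y, y', hy, h, rfl⟩
    obtain ⟨B, hB, hb⟩ := beh_eq_iff.1 h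
    obtain ⟨x', hx, hb'⟩ := hB.forth _ _ hb a y' hy
    have e : beh N y' = beh M x' := beh_eq_iff.2 ⟨B, hB, hb'⟩
    exact ⟨x', hx, e.symm⟩

/-- Finality: `beh M` is the only coalgebra morphism from `M` to the final coalgebra. -/
theorem finalModel_isFinal (M : Model.{u, v, w} Ag AtProp) :
    ∃! f : M.W → (finalModel.{u, v, w} Ag AtProp).W,
      IsMorphism M (finalModel.{u, v, w} Ag AtProp) f := by
  refine ⟨beh M, beh_isMorphism M, fun f hf => funext fun x => ?_⟩
  obtain ⟨⟨N, y⟩, hy⟩ := Quotient.exists_rep (f x)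
  have hy : beh N y = f x := hy
  have hN := beh_isMorphism N
  refine hy.symm.trans (beh_eq_iff.2 ?_)
  refine ⟨fun t s => beh N t = f s, ⟨?_, ?_, ?_⟩, hy⟩
  · intro t s h p
    rw [hN.atom t p, h, ← hf.atom s p]
  · intro t s h a t' ht
    obtain ⟨s', hs, e⟩ := hf.back s a (beh N t') (h ▸ hN.forth t a t' ht)
    exact ⟨s', hs, e.symm⟩
  · intro t s h a s' hs
    exact hN.back t a (f s') (h ▸ hf.forth s a s' hs)

/-- The interpretation `α_ℤ` of an action on the final coalgebra: `z α_ℤ z'` iff there is a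
pointed model `(M, x)` with `M, x ⊩ Pre(α)` such that the morphisms `M → ℤ` and `M^α → ℤ` map
`x` to `z` and `(x, k)` to `z'`. -/
def actionRel (α : Action Ag AtProp) (z z' : FinalCarrier.{u, v, w} Ag AtProp) : Prop :=
  ∃ (M : Model.{u, v, w} Ag AtProp) (x : M.W) (h : x ∈ α.pre.ext M),
    beh M x = z ∧ beh (M.update α) ⟨(x, α.point), h⟩ = z'

end Models

/-! ## Modal operators of a relation -/

section Operators

variable {X : Type u} {Y : Type v}

/-- `⟨R⟩ U`. -/
def fDia (R : X → Y → Prop) (U : Set Y) : Set X := {x | ∃ y, R x y ∧ y ∈ U}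

/-- `[R] U`. -/
def fBox (R : X → Y → Prop) (U : Set Y) : Set X := {x | ∀ y, R x y → y ∈ U}

/-- `⟨R⁻¹⟩ U`. -/
def pDia (R : X → Y → Prop) (U : Set X) : Set Y := {y | ∃ x, R x y ∧ x ∈ U}

/-- `[R⁻¹] U`. -/
def pBox (R : X → Y → Prop) (U : Set X) : Set Y := {y | ∀ x, R x y → x ∈ U}

end Operators

/-! ## The language of D'.EAK -/

/-- Formulas of D'.EAK. -/
inductive Fm (Ag : Type u) (AtProp : Type v) : Type (max u v)
  | atom (p : AtProp)
  | bot
  | top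
  | and (A B : Fm Ag AtProp)
  | or (A B : Fm Ag AtProp)
  /-- `A → B` -/
  | imp (A B : Fm Ag AtProp)
  /-- `B ← A` -/
  | pmi (B A : Fm Ag AtProp)
  /-- `A ⤚ B`, the left residual of disjunction that `>` stands for in precedent position
  (`B` and not `A`) -/
  | rsub (A B : Fm Ag AtProp)
  /-- `B ⤙ A`, which `<` stands for in precedent position (`B` and not `A`) -/
  | lsub (B A : Fm Ag AtProp)
  /-- `⟨a⟩A`, `[a]A` and their adjoints -/
  | agDia (a : Ag) (A : Fm Ag AtProp)
  | agBox (a : Ag) (A : Fm Ag AtProp)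
  | agConvDia (a : Ag) (A : Fm Ag AtProp)
  | agConvBox (a : Ag) (A : Fm Ag AtProp)
  /-- `⟨α⟩A`, `[α]A` and their adjoints -/
  | actDia (α : Action Ag AtProp) (A : Fm Ag AtProp)
  | actBox (α : Action Ag AtProp) (A : Fm Ag AtProp)
  | actConvDia (α : Action Ag AtProp) (A : Fm Ag AtProp)
  | actConvBox (α : Action Ag AtProp) (A : Fm Ag AtProp)
  /-- `1_α` -/
  | one (α : Action Ag AtProp)

/-- Structures of D'.EAK. -/
inductive Struct (Ag : Type u) (AtProp : Type v) : Type (max u v)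
  | fm (A : Fm Ag AtProp)
  | I
  /-- `X ; Y` -/
  | semi (X Y : Struct Ag AtProp)
  /-- `X > Y` -/
  | gt (X Y : Struct Ag AtProp)
  /-- `X < Y` -/
  | lt (X Y : Struct Ag AtProp)
  /-- `{a}X` and its adjoint -/
  | ag (a : Ag) (X : Struct Ag AtProp)
  | agConv (a : Ag) (X : Struct Ag AtProp)
  /-- `{α}X` and its adjoint -/
  | act (α : Action Ag AtProp) (X : Struct Ag AtProp)
  | actConv (α : Action Ag AtProp) (X : Struct Ag AtProp)
  /-- `Φ_α` -/
  | phi (α : Action Ag AtProp)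

/-- Sequents `X ⊢ Y`. -/
structure Sequent (Ag : Type u) (AtProp : Type v) where
  left : Struct Ag AtProp
  right : Struct Ag AtProp

infix:40 " ⊢ₛ " => Sequent.mk

/-- Precedent and succedent position. -/
inductive Pos
  | prec
  | succ

section Semantics

variable {Ag : Type u} {AtProp : Type v}

/-! ## Semantics in the final coalgebra -/

/-- The extension `⟦A⟧_ℤ` of a D'.EAK-formula in the final coalgebra. -/
def Fm.ext : Fm Ag AtProp → Set (finalModel.{u, v, w} Ag AtProp).W
  | .atom p => (finalModel Ag AtProp).V p
  | .bot => ∅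
  | .top => Set.univ
  | .and A B => A.ext ∩ B.ext
  | .or A B => A.ext ∪ B.ext
  | .imp A B => A.extᶜ ∪ B.ext
  | .pmi B A => A.extᶜ ∪ B.ext
  | .rsub A B => B.ext \ A.ext
  | .lsub B A => B.ext \ A.ext
  | .agDia a A => fDia ((finalModel Ag AtProp).R a) A.ext
  | .agBox a A => fBox ((finalModel Ag AtProp).R a) A.ext
  | .agConvDia a A => pDia ((finalModel Ag AtProp).R a) A.ext
  | .agConvBox a A => pBox ((finalModel Ag AtProp).R a) A.ext
  | .actDia α A => fDia (actionRel α) A.ext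
  | .actBox α A => fBox (actionRel α) A.ext
  | .actConvDia α A => pDia (actionRel α) A.ext
  | .actConvBox α A => pBox (actionRel α) A.ext
  | .one α => α.pre.ext (finalModel Ag AtProp)

/-- Translation of structures into formulas according to their position. The constant `Φ_α` is
read as `1_α` in precedent position. It is not meant to be used in succedent position; there it
is read as the formula `post α`, where `post` is arbitrary. -/
def Struct.toFm (post : Action Ag AtProp → Fm Ag AtProp) :
    Pos → Struct Ag AtProp → Fm Ag AtProp
  | _, .fm A => A
  | .prec, .I => .top
  | .succ, .I => .bot
  | .prec, .semi X Y => .and (X.toFm post .prec) (Y.toFm post .prec)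
  | .succ, .semi X Y => .or (X.toFm post .succ) (Y.toFm post .succ)
  | .prec, .gt X Y => .rsub (X.toFm post .succ) (Y.toFm post .prec)
  | .succ, .gt X Y => .imp (X.toFm post .prec) (Y.toFm post .succ)
  | .prec, .lt X Y => .lsub (X.toFm post .prec) (Y.toFm post .succ)
  | .succ, .lt X Y => .pmi (X.toFm post .succ) (Y.toFm post .prec)
  | .prec, .ag a X => .agDia a (X.toFm post .prec)
  | .succ, .ag a X => .agBox a (X.toFm post .succ)
  | .prec, .agConv a X => .agConvDia a (X.toFm post .prec)
  | .succ, .agConv a X => .agConvBox a (X.toFm post .succ)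
  | .prec, .act α X => .actDia α (X.toFm post .prec)
  | .succ, .act α X => .actBox α (X.toFm post .succ)
  | .prec, .actConv α X => .actConvDia α (X.toFm post .prec)
  | .succ, .actConv α X => .actConvBox α (X.toFm post .succ)
  | .prec, .phi α => .one α
  | .succ, .phi α => post α

/-- A sequent `X ⊢ Y` holds in the final coalgebra (over models with carrier in `Type w`) iff
`⟦X⟧_ℤ ⊆ ⟦Y⟧_ℤ`. -/
def Sequent.Holds (post : Action Ag AtProp → Fm Ag AtProp) (s : Sequent Ag AtProp) : Prop :=
  Fm.ext.{u, v, w} (s.left.toFm post .prec) ⊆ Fm.ext.{u, v, w} (s.right.toFm post .succ)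

end Semantics

/-! ## The calculus D'.EAK -/

section Calculus

variable {Ag : Type u} {AtProp : Type v}

/-- One element of the sequences `Γ`, `Δ` of the rule *atom*: `{α}` or its adjoint. -/
inductive Step (Ag : Type u) (AtProp : Type v) : Type (max u v)
  | fwd (α : Action Ag AtProp)
  | bwd (α : Action Ag AtProp)

/-- Prefix a single proxy to a structure. -/
def Step.apply : Step Ag AtProp → Struct Ag AtProp → Struct Ag AtProp
  | .fwd α, X => .act α X
  | .bwd α, X => .actConv α X

/-- The structure `Γ X` for a finite sequence `Γ` of proxies. -/
def prefixed (Γ : List (Step Ag AtProp)) (X : Struct Ag AtProp) : Struct Ag AtProp :=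
  Γ.foldr Step.apply X

/-- The structure `(⋯(Y ; Y) ; ⋯ ; Y)` with `n` occurrences of `Y`; it is `I` for `n = 0`. -/
def semis (Y : Struct Ag AtProp) : ℕ → Struct Ag AtProp
  | 0 => .I
  | 1 => Y
  | n + 2 => .semi (semis Y (n + 1)) Y

/-- `;(Y | α a β)`, with as many occurrences of `Y` as there are actions `β` such that `α a β`. -/
noncomputable def semiSeen (α : Action Ag AtProp) (a : Ag) (Y : Struct Ag AtProp) :
    Struct Ag AtProp :=
  semis Y {β | α.Sees a β}.ncard

open Struct in
/-- The rules of D'.EAK: `Rule P s` says that `s` is the conclusion of an instance of a rule with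
set of premises `P`. The two directions of an invertible rule are marked `_down` and `_up`. -/
inductive Rule : Set (Sequent Ag AtProp) → Sequent Ag AtProp → Prop
  -- structural rules of the propositional base
  | id (p) : Rule ∅ (fm (.atom p) ⊢ₛ fm (.atom p))
  | cut (X Y A) : Rule {X ⊢ₛ fm A, fm A ⊢ₛ Y} (X ⊢ₛ Y)
  | I1L_down (X Y) : Rule {X ⊢ₛ Y} (I ⊢ₛ lt Y X)
  | I1L_up (X Y) : Rule {I ⊢ₛ lt Y X} (X ⊢ₛ Y)
  | I1R_down (X Y) : Rule {X ⊢ₛ Y} (lt X Y ⊢ₛ I)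
  | I1R_up (X Y) : Rule {lt X Y ⊢ₛ I} (X ⊢ₛ Y)
  | I2L_down (X Y) : Rule {X ⊢ₛ Y} (I ⊢ₛ gt X Y)
  | I2L_up (X Y) : Rule {I ⊢ₛ gt X Y} (X ⊢ₛ Y)
  | I2R_down (X Y) : Rule {X ⊢ₛ Y} (gt Y X ⊢ₛ I)
  | I2R_up (X Y) : Rule {gt Y X ⊢ₛ I} (X ⊢ₛ Y)
  | IWL (X Y) : Rule {I ⊢ₛ X} (Y ⊢ₛ X)
  | IWR (X Y) : Rule {X ⊢ₛ I} (X ⊢ₛ Y)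
  | W1L (X Y Z) : Rule {X ⊢ₛ Z} (Y ⊢ₛ lt Z X)
  | W1R (X Y Z) : Rule {X ⊢ₛ Z} (lt X Z ⊢ₛ Y)
  | W2L (X Y Z) : Rule {X ⊢ₛ Z} (Y ⊢ₛ gt X Z)
  | W2R (X Y Z) : Rule {X ⊢ₛ Z} (gt Z X ⊢ₛ Y)
  | CL (X Y) : Rule {semi X X ⊢ₛ Y} (X ⊢ₛ Y)
  | CR (X Y) : Rule {Y ⊢ₛ semi X X} (Y ⊢ₛ X)
  | EL (X Y Z) : Rule {semi Y X ⊢ₛ Z} (semi X Y ⊢ₛ Z)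
  | ER (X Y Z) : Rule {Z ⊢ₛ semi X Y} (Z ⊢ₛ semi Y X)
  | AL (X Y Z W) : Rule {semi X (semi Y Z) ⊢ₛ W} (semi (semi X Y) Z ⊢ₛ W)
  | AR (X Y Z W) : Rule {W ⊢ₛ semi (semi Z Y) X} (W ⊢ₛ semi Z (semi Y X))
  -- display postulates of the propositional base
  | semi_lt_down (X Y Z) : Rule {semi X Y ⊢ₛ Z} (X ⊢ₛ lt Z Y)
  | semi_lt_up (X Y Z) : Rule {X ⊢ₛ lt Z Y} (semi X Y ⊢ₛ Z)
  | lt_semi_down (X Y Z) : Rule {Z ⊢ₛ semi X Y} (lt Z Y ⊢ₛ X)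
  | lt_semi_up (X Y Z) : Rule {lt Z Y ⊢ₛ X} (Z ⊢ₛ semi X Y)
  | semi_gt_down (X Y Z) : Rule {semi X Y ⊢ₛ Z} (Y ⊢ₛ gt X Z)
  | semi_gt_up (X Y Z) : Rule {Y ⊢ₛ gt X Z} (semi X Y ⊢ₛ Z)
  | gt_semi_down (X Y Z) : Rule {Z ⊢ₛ semi X Y} (gt X Z ⊢ₛ Y)
  | gt_semi_up (X Y Z) : Rule {gt X Z ⊢ₛ Y} (Z ⊢ₛ semi X Y)
  -- Grishin rules
  | griL_down (X Y Z W) : Rule {gt X (semi Y Z) ⊢ₛ W} (semi (gt X Y) Z ⊢ₛ W)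
  | griL_up (X Y Z W) : Rule {semi (gt X Y) Z ⊢ₛ W} (gt X (semi Y Z) ⊢ₛ W)
  | griR_down (X Y Z W) : Rule {W ⊢ₛ gt X (semi Y Z)} (W ⊢ₛ semi (gt X Y) Z)
  | griR_up (X Y Z W) : Rule {W ⊢ₛ semi (gt X Y) Z} (W ⊢ₛ gt X (semi Y Z))
  -- operational rules of the propositional base
  | botL : Rule ∅ (fm .bot ⊢ₛ I)
  | botR (X) : Rule {X ⊢ₛ I} (X ⊢ₛ fm .bot)
  | topL (X) : Rule {I ⊢ₛ X} (fm .top ⊢ₛ X)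
  | topR : Rule ∅ (I ⊢ₛ fm .top)
  | andL (A B Z) : Rule {semi (fm A) (fm B) ⊢ₛ Z} (fm (.and A B) ⊢ₛ Z)
  | andR (A B X Y) : Rule {X ⊢ₛ fm A, Y ⊢ₛ fm B} (semi X Y ⊢ₛ fm (.and A B))
  | orL (A B X Y) : Rule {fm A ⊢ₛ X, fm B ⊢ₛ Y} (fm (.or A B) ⊢ₛ semi X Y)
  | orR (A B Z) : Rule {Z ⊢ₛ semi (fm A) (fm B)} (Z ⊢ₛ fm (.or A B))
  | pmiL (A B X Y) : Rule {fm B ⊢ₛ Y, X ⊢ₛ fm A} (fm (.pmi B A) ⊢ₛ lt Y X)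
  | pmiR (A B Z) : Rule {Z ⊢ₛ lt (fm B) (fm A)} (Z ⊢ₛ fm (.pmi B A))
  | lsubL (A B Z) : Rule {lt (fm B) (fm A) ⊢ₛ Z} (fm (.lsub B A) ⊢ₛ Z)
  | lsubR (A B X Y) : Rule {Y ⊢ₛ fm B, fm A ⊢ₛ X} (lt Y X ⊢ₛ fm (.lsub B A))
  | impL (A B X Y) : Rule {X ⊢ₛ fm A, fm B ⊢ₛ Y} (fm (.imp A B) ⊢ₛ gt X Y)
  | impR (A B Z) : Rule {Z ⊢ₛ gt (fm A) (fm B)} (Z ⊢ₛ fm (.imp A B))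
  | rsubL (A B Z) : Rule {gt (fm A) (fm B) ⊢ₛ Z} (fm (.rsub A B) ⊢ₛ Z)
  | rsubR (A B X Y) : Rule {fm A ⊢ₛ X, Y ⊢ₛ fm B} (gt X Y ⊢ₛ fm (.rsub A B))
  -- structural rules of the epistemic modalities
  | ag_necL (a X) : Rule {I ⊢ₛ X} (ag a I ⊢ₛ X)
  | ag_necR (a X) : Rule {X ⊢ₛ I} (X ⊢ₛ ag a I)
  | agConv_necL (a X) : Rule {I ⊢ₛ X} (agConv a I ⊢ₛ X)
  | agConv_necR (a X) : Rule {X ⊢ₛ I} (X ⊢ₛ agConv a I)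
  | ag_FSL (a X Y Z) : Rule {gt (ag a Y) (ag a Z) ⊢ₛ X} (ag a (gt Y Z) ⊢ₛ X)
  | ag_FSR (a X Y Z) : Rule {Y ⊢ₛ gt (ag a X) (ag a Z)} (Y ⊢ₛ ag a (gt X Z))
  | ag_monL (a X Y Z) : Rule {semi (ag a X) (ag a Y) ⊢ₛ Z} (ag a (semi X Y) ⊢ₛ Z)
  | ag_monR (a X Y Z) : Rule {Z ⊢ₛ semi (ag a Y) (ag a X)} (Z ⊢ₛ ag a (semi Y X))
  | agConv_FSL (a X Y Z) :
      Rule {gt (agConv a Y) (agConv a X) ⊢ₛ Z} (agConv a (gt Y X) ⊢ₛ Z)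
  | agConv_FSR (a X Y Z) :
      Rule {Y ⊢ₛ gt (agConv a X) (agConv a Z)} (Y ⊢ₛ agConv a (gt X Z))
  | agConv_monL (a X Y Z) :
      Rule {semi (agConv a X) (agConv a Y) ⊢ₛ Z} (agConv a (semi X Y) ⊢ₛ Z)
  | agConv_monR (a X Y Z) :
      Rule {Z ⊢ₛ semi (agConv a Y) (agConv a X)} (Z ⊢ₛ agConv a (semi Y X))
  -- display postulates of the epistemic modalities
  | ag_agConv_down (a X Y) : Rule {ag a X ⊢ₛ Y} (X ⊢ₛ agConv a Y)
  | ag_agConv_up (a X Y) : Rule {X ⊢ₛ agConv a Y} (ag a X ⊢ₛ Y)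
  | agConv_ag_down (a X Y) : Rule {X ⊢ₛ ag a Y} (agConv a X ⊢ₛ Y)
  | agConv_ag_up (a X Y) : Rule {agConv a X ⊢ₛ Y} (X ⊢ₛ ag a Y)
  -- operational rules of the epistemic modalities
  | agDiaL (a A X) : Rule {ag a (fm A) ⊢ₛ X} (fm (.agDia a A) ⊢ₛ X)
  | agDiaR (a A X) : Rule {X ⊢ₛ fm A} (ag a X ⊢ₛ fm (.agDia a A))
  | agBoxL (a A X) : Rule {fm A ⊢ₛ X} (fm (.agBox a A) ⊢ₛ ag a X)
  | agBoxR (a A X) : Rule {X ⊢ₛ ag a (fm A)} (X ⊢ₛ fm (.agBox a A))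
  | agConvDiaL (a A X) : Rule {agConv a (fm A) ⊢ₛ X} (fm (.agConvDia a A) ⊢ₛ X)
  | agConvDiaR (a A X) : Rule {X ⊢ₛ fm A} (agConv a X ⊢ₛ fm (.agConvDia a A))
  | agConvBoxL (a A X) : Rule {fm A ⊢ₛ X} (fm (.agConvBox a A) ⊢ₛ agConv a X)
  | agConvBoxR (a A X) : Rule {X ⊢ₛ agConv a (fm A)} (X ⊢ₛ fm (.agConvBox a A))
  -- structural rules of the dynamic modalities
  | act_necL (α X) : Rule {I ⊢ₛ X} (act α I ⊢ₛ X)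
  | act_necR (α X) : Rule {X ⊢ₛ I} (X ⊢ₛ act α I)
  | actConv_necL (α X) : Rule {I ⊢ₛ X} (actConv α I ⊢ₛ X)
  | actConv_necR (α X) : Rule {X ⊢ₛ I} (X ⊢ₛ actConv α I)
  | act_FSL (α X Y Z) : Rule {gt (act α Y) (act α Z) ⊢ₛ X} (act α (gt Y Z) ⊢ₛ X)
  | act_FSR (α X Y Z) : Rule {Y ⊢ₛ gt (act α X) (act α Z)} (Y ⊢ₛ act α (gt X Z))
  | act_monL (α X Y Z) : Rule {semi (act α X) (act α Y) ⊢ₛ Z} (act α (semi X Y) ⊢ₛ Z)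
  | act_monR (α X Y Z) : Rule {Z ⊢ₛ semi (act α Y) (act α X)} (Z ⊢ₛ act α (semi Y X))
  | actConv_FSL (α X Y Z) :
      Rule {gt (actConv α Y) (actConv α X) ⊢ₛ Z} (actConv α (gt Y X) ⊢ₛ Z)
  | actConv_FSR (α X Y Z) :
      Rule {Y ⊢ₛ gt (actConv α X) (actConv α Z)} (Y ⊢ₛ actConv α (gt X Z))
  | actConv_monL (α X Y Z) :
      Rule {semi (actConv α X) (actConv α Y) ⊢ₛ Z} (actConv α (semi X Y) ⊢ₛ Z)
  | actConv_monR (α X Y Z) :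
      Rule {Z ⊢ₛ semi (actConv α Y) (actConv α X)} (Z ⊢ₛ actConv α (semi Y X))
  -- display postulates of the dynamic modalities
  | act_actConv_down (α X Y) : Rule {act α X ⊢ₛ Y} (X ⊢ₛ actConv α Y)
  | act_actConv_up (α X Y) : Rule {X ⊢ₛ actConv α Y} (act α X ⊢ₛ Y)
  | actConv_act_down (α X Y) : Rule {Y ⊢ₛ act α X} (actConv α Y ⊢ₛ X)
  | actConv_act_up (α X Y) : Rule {actConv α Y ⊢ₛ X} (Y ⊢ₛ act α X)
  -- rules for epistemic actions
  | atom (Γ Δ p) : Rule ∅ (prefixed Γ (fm (.atom p)) ⊢ₛ prefixed Δ (fm (.atom p)))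
  | balance (α X Y) : Rule {X ⊢ₛ Y} (act α X ⊢ₛ act α Y)
  | compL (α X Y) : Rule {act α (actConv α X) ⊢ₛ Y} (semi (phi α) X ⊢ₛ Y)
  | compR (α X Y) : Rule {X ⊢ₛ act α (actConv α Y)} (X ⊢ₛ gt (phi α) Y)
  | reduceL (α X Y) : Rule {semi (phi α) (act α X) ⊢ₛ Y} (act α X ⊢ₛ Y)
  | reduceR (α X Y) : Rule {Y ⊢ₛ gt (phi α) (act α X)} (Y ⊢ₛ act α X)
  | swapInL (α β a X Y) (h : α.Sees a β) :
      Rule {act α (ag a X) ⊢ₛ Y} (semi (phi α) (ag a (act β X)) ⊢ₛ Y)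
  | swapInR (α β a X Y) (h : α.Sees a β) :
      Rule {Y ⊢ₛ act α (ag a X)} (Y ⊢ₛ gt (phi α) (ag a (act β X)))
  | swapOutL (α a X Y) :
      Rule {s | ∃ β, α.Sees a β ∧ s = (ag a (act β X) ⊢ₛ Y)}
        (act α (ag a X) ⊢ₛ semiSeen α a Y)
  | swapOutR (α a X Y) :
      Rule {s | ∃ β, α.Sees a β ∧ s = (Y ⊢ₛ ag a (act β X))}
        (semiSeen α a Y ⊢ₛ act α (ag a X))
  -- operational rules of the dynamic modalities and of `1_α`
  | actDiaL (α A X) : Rule {act α (fm A) ⊢ₛ X} (fm (.actDia α A) ⊢ₛ X)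
  | actDiaR (α A X) : Rule {X ⊢ₛ fm A} (act α X ⊢ₛ fm (.actDia α A))
  | actBoxL (α A X) : Rule {fm A ⊢ₛ X} (fm (.actBox α A) ⊢ₛ act α X)
  | actBoxR (α A X) : Rule {X ⊢ₛ act α (fm A)} (X ⊢ₛ fm (.actBox α A))
  | actConvDiaL (α A X) : Rule {actConv α (fm A) ⊢ₛ X} (fm (.actConvDia α A) ⊢ₛ X)
  | actConvDiaR (α A X) : Rule {X ⊢ₛ fm A} (actConv α X ⊢ₛ fm (.actConvDia α A))
  | actConvBoxL (α A X) : Rule {fm A ⊢ₛ X} (fm (.actConvBox α A) ⊢ₛ actConv α X)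
  | actConvBoxR (α A X) : Rule {X ⊢ₛ actConv α (fm A)} (X ⊢ₛ fm (.actConvBox α A))
  | oneL (α X) : Rule {phi α ⊢ₛ X} (fm (.one α) ⊢ₛ X)
  | oneR (α) : Rule ∅ (phi α ⊢ₛ fm (.one α))

/-- Derivability in D'.EAK. -/
inductive Derivable : Sequent Ag AtProp → Prop
  | step {P : Set (Sequent Ag AtProp)} {s : Sequent Ag AtProp} :
      Rule P s → (∀ t ∈ P, Derivable t) → Derivable s

end Calculus

end EAK

/-!
The final coalgebra interprets an action `α` by a relation that can be computed on representatives: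
updating bisimilar points gives bisimilar points, so `beh M x` is related to `z` iff `M, x`
satisfies `Pre(α)` and `z` is the behaviour of `(x, k)` in `M^α`. Hence `α_ℤ` is a partial function
with domain `⟦Pre(α)⟧` that preserves the valuation, and unfolding the accessibility relation of
`M^α` gives the reduction law `⟨α⟩⟨a⟩U = ⟦Pre(α)⟧ ∩ ⋃_{α a β} ⟨a⟩⟨β⟩U`. The first three facts
account for *balance*, *comp*, *reduce'* and *atom*, the reduction law and its dual for *swap-in'*
and *swap-out'*. All other rules hold for diamonds and boxes of an arbitrary relation.
-/

namespace EAK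

open Set

section Operators

variable {X : Type u} {Y : Type v} (R : X → Y → Prop)

theorem gc_fDia_pBox : GaloisConnection (fDia R) (pBox R) := fun _ _ =>
  ⟨fun h _ hy _ hxy => h ⟨_, hxy, hy⟩, fun h _ ⟨_, hxy, hy⟩ => h hy _ hxy⟩

theorem gc_pDia_fBox : GaloisConnection (pDia R) (fBox R) :=
  gc_fDia_pBox (flip R)

variable {R} in
theorem fDia_mono {U V : Set Y} (h : U ⊆ V) : fDia R U ⊆ fDia R V :=
  (gc_fDia_pBox R).monotone_l h

variable {R} in
theorem fBox_mono {U V : Set Y} (h : U ⊆ V) : fBox R U ⊆ fBox R V :=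
  (gc_pDia_fBox R).monotone_u h

theorem compl_fDia (U : Set Y) : (fDia R U)ᶜ = fBox R Uᶜ := by
  ext x
  exact ⟨fun h y hxy hy => h ⟨y, hxy, hy⟩, fun h ⟨y, hxy, hy⟩ => h y hxy hy⟩

theorem fDia_inter_subset (U V : Set Y) : fDia R (U ∩ V) ⊆ fDia R U ∩ fDia R V :=
  (gc_fDia_pBox R).monotone_l.map_inf_le U V

theorem fBox_union_subset (U V : Set Y) : fBox R U ∪ fBox R V ⊆ fBox R (U ∪ V) :=
  (gc_pDia_fBox R).monotone_u.le_map_sup U V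

theorem fDia_sdiff_subset (U V : Set Y) : fDia R (V \ U) ⊆ fDia R V \ fBox R U :=
  fun _ ⟨y, hxy, hV, hU⟩ => ⟨⟨y, hxy, hV⟩, fun h => hU (h y hxy)⟩

theorem compl_fDia_union_fBox_subset (U V : Set Y) :
    (fDia R U)ᶜ ∪ fBox R V ⊆ fBox R (Uᶜ ∪ V) := by
  rw [compl_fDia]
  exact fBox_union_subset R Uᶜ V

theorem fDia_univ_inter_subset_fDia_pDia (U : Set X) : fDia R univ ∩ U ⊆ fDia R (pDia R U) := by
  rintro x ⟨⟨y, hxy, -⟩, hx⟩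
  exact ⟨y, hxy, x, hxy, hx⟩

theorem fBox_pBox_subset (U : Set X) : fBox R (pBox R U) ⊆ (fDia R univ)ᶜ ∪ U := by
  intro x hx
  by_cases hdom : x ∈ fDia R univ
  · obtain ⟨y, hxy, -⟩ := hdom
    exact .inr (hx y hxy x hxy)
  · exact .inl hdom

theorem fDia_univ_inter_fDia (U : Set Y) : fDia R univ ∩ fDia R U = fDia R U :=
  inter_eq_right.2 (fDia_mono (subset_univ U))

theorem compl_fDia_univ_union_fBox (U : Set Y) : (fDia R univ)ᶜ ∪ fBox R U = fBox R U := by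
  rw [compl_fDia, compl_univ]
  exact union_eq_right.2 (fBox_mono (empty_subset U))

variable {R} in
theorem fDia_subset_fBox (hR : Relator.RightUnique R) (U : Set Y) : fDia R U ⊆ fBox R U :=
  fun _ ⟨_, hxy, hy⟩ _ hxy' => hR hxy hxy' ▸ hy

end Operators

section Invariance

variable {Ag : Type u} {AtProp : Type v}

theorem IsBisimulation.product {M : Model.{u, v, w} Ag AtProp} {N : Model.{u, v, w'} Ag AtProp}
    {B : M.W → N.W → Prop} (hB : IsBisimulation M N B) {n : ℕ} (r : Ag → Fin n → Fin n → Prop)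
    {S : Fin n → Set M.W} {T : Fin n → Set N.W}
    (hST : ∀ j x y, B x y → (x ∈ S j ↔ y ∈ T j)) :
    IsBisimulation (M.product r S) (N.product r T)
      (fun x y => B x.1.1 y.1.1 ∧ x.1.2 = y.1.2) where
  atom _ _ h p := hB.atom _ _ h.1 p
  forth := by
    rintro ⟨⟨x, i⟩, _⟩ ⟨⟨y, _⟩, _⟩ ⟨hxy, rfl⟩ a ⟨⟨x', j⟩, hx'⟩ ⟨hR, hr⟩
    obtain ⟨y', hy', hb⟩ := hB.forth _ _ hxy a x' hR
    exact ⟨⟨(y', j), (hST j x' y' hb).1 hx'⟩, ⟨hy', hr⟩, hb, rfl⟩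
  back := by
    rintro ⟨⟨x, i⟩, _⟩ ⟨⟨y, _⟩, _⟩ ⟨hxy, rfl⟩ a ⟨⟨y', j⟩, hy'⟩ ⟨hR, hr⟩
    obtain ⟨x', hx', hb⟩ := hB.back _ _ hxy a y' hR
    exact ⟨⟨(x', j), (hST j x' y' hb).2 hy'⟩, ⟨hx', hr⟩, hb, rfl⟩

theorem IsBisimulation.mem_ext_iff {M : Model.{u, v, w} Ag AtProp}
    {N : Model.{u, v, w'} Ag AtProp} {B : M.W → N.W → Prop} (hB : IsBisimulation M N B)
    {x : M.W} {y : N.W} (h : B x y) : (A : Formula Ag AtProp) → (x ∈ A.ext M ↔ y ∈ A.ext N)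
  | .atom p => hB.atom x y h p
  | .neg A => not_congr (hB.mem_ext_iff h A)
  | .or A A' => or_congr (hB.mem_ext_iff h A) (hB.mem_ext_iff h A')
  | .dia a A => by
    constructor
    · rintro ⟨x', hxx', hA⟩
      obtain ⟨y', hyy', h'⟩ := hB.forth x y h a x' hxx'
      exact ⟨y', hyy', (hB.mem_ext_iff h' A).1 hA⟩
    · rintro ⟨y', hyy', hA⟩
      obtain ⟨x', hxx', h'⟩ := hB.back x y h a y' hyy'
      exact ⟨x', hxx', (hB.mem_ext_iff h' A).2 hA⟩
  | .act (.mk _ k r pre) A => by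
    have hupdate := hB.product r fun j _ _ h' => hB.mem_ext_iff h' (pre j)
    exact exists_prop_congr (fun hx => hupdate.mem_ext_iff
      (x := ⟨(x, k), hx⟩) (y := ⟨(y, k), (hB.mem_ext_iff h (pre k)).1 hx⟩) ⟨h, rfl⟩ A)
      (hB.mem_ext_iff h (pre k))

theorem IsBisimulation.update {M : Model.{u, v, w} Ag AtProp} {N : Model.{u, v, w'} Ag AtProp}
    {B : M.W → N.W → Prop} (hB : IsBisimulation M N B) (α : Action Ag AtProp) :
    IsBisimulation (M.update α) (N.update α) (fun x y => B x.1.1 y.1.1 ∧ x.1.2 = y.1.2) :=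
  hB.product α.rel fun j _ _ h => hB.mem_ext_iff h (α.preAt j)

theorem IsMorphism.isBisimulation {M : Model.{u, v, w} Ag AtProp}
    {N : Model.{u, v, w'} Ag AtProp} {f : M.W → N.W} (hf : IsMorphism M N f) :
    IsBisimulation M N (fun x y => f x = y) where
  atom := by rintro x _ rfl p; exact hf.atom x p
  forth := by rintro x _ rfl a x' h; exact ⟨f x', hf.forth x a x' h, rfl⟩
  back := by rintro x _ rfl a y h; exact hf.back x a y h

theorem IsMorphism.mem_ext_iff {M : Model.{u, v, w} Ag AtProp} {N : Model.{u, v, w'} Ag AtProp}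
    {f : M.W → N.W} (hf : IsMorphism M N f) {x : M.W} (A : Formula Ag AtProp) :
    f x ∈ A.ext N ↔ x ∈ A.ext M :=
  (hf.isBisimulation.mem_ext_iff rfl A).symm

theorem exists_beh_eq (z : FinalCarrier.{u, v, w} Ag AtProp) :
    ∃ (M : Model.{u, v, w} Ag AtProp) (x : M.W), beh M x = z :=
  let ⟨⟨M, x⟩, h⟩ := Quotient.exists_rep z
  ⟨M, x, h⟩

end Invariance

section ActionRel

variable {Ag : Type u} {AtProp : Type v} {α : Action Ag AtProp}

theorem actionRel_beh_iff {M : Model.{u, v, w} Ag AtProp} {x : M.W}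
    {z : FinalCarrier.{u, v, w} Ag AtProp} :
    actionRel α (beh M x) z ↔
      ∃ h : x ∈ α.pre.ext M, beh (M.update α) ⟨(x, α.point), h⟩ = z := by
  refine ⟨?_, fun ⟨h, hz⟩ => ⟨M, x, h, rfl, hz⟩⟩
  rintro ⟨N, y, hy, hyx, rfl⟩
  obtain ⟨B, hB, hb⟩ := beh_eq_iff.1 hyx.symm
  exact ⟨(hB.mem_ext_iff hb α.pre).2 hy, beh_eq_iff.2 ⟨_, hB.update α, hb, rfl⟩⟩

theorem actionRel_rightUnique (α : Action Ag AtProp) :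
    Relator.RightUnique (actionRel.{u, v, w} α) := by
  intro z z₁ z₂ h₁ h₂
  obtain ⟨M, x, rfl⟩ := exists_beh_eq z
  obtain ⟨_, rfl⟩ := actionRel_beh_iff.1 h₁
  obtain ⟨_, rfl⟩ := actionRel_beh_iff.1 h₂
  rfl

theorem fDia_actionRel_univ (α : Action Ag AtProp) :
    fDia (actionRel α) univ = α.pre.ext (finalModel.{u, v, w} Ag AtProp) := by
  ext z
  obtain ⟨M, x, rfl⟩ := exists_beh_eq z
  rw [(beh_isMorphism M).mem_ext_iff]
  constructor
  · rintro ⟨_, h, -⟩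
    exact (actionRel_beh_iff.1 h).1
  · exact fun hx => ⟨_, actionRel_beh_iff.2 ⟨hx, rfl⟩, mem_univ _⟩

theorem actionRel_mem_V_iff {z z' : FinalCarrier.{u, v, w} Ag AtProp} (h : actionRel α z z')
    (p : AtProp) :
    z ∈ (finalModel.{u, v, w} Ag AtProp).V p ↔ z' ∈ (finalModel.{u, v, w} Ag AtProp).V p := by
  obtain ⟨M, x, hx, rfl, rfl⟩ := h
  exact ((beh_isMorphism M).atom x p).symm.trans
    ((beh_isMorphism (M.update α)).atom ⟨(x, α.point), hx⟩ p)

theorem comp_actionRel_R_iff {a : Ag} {z z' : FinalCarrier.{u, v, w} Ag AtProp} :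
    Relation.Comp (actionRel α) ((finalModel.{u, v, w} Ag AtProp).R a) z z' ↔
      z ∈ α.pre.ext (finalModel.{u, v, w} Ag AtProp) ∧ ∃ β, α.Sees a β ∧
        Relation.Comp ((finalModel.{u, v, w} Ag AtProp).R a) (actionRel β) z z' := by
  obtain ⟨M, x, rfl⟩ := exists_beh_eq z
  rw [(beh_isMorphism M).mem_ext_iff]
  constructor
  · rintro ⟨_, hα, hR⟩
    obtain ⟨hx, rfl⟩ := actionRel_beh_iff.1 hα
    obtain ⟨⟨⟨x', i⟩, hx'⟩, ⟨hxx', hi⟩, rfl⟩ := (beh_isMorphism (M.update α)).back _ a z' hR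
    exact ⟨hx, α.withPoint i, ⟨i, hi, rfl⟩, beh M x', (beh_isMorphism M).forth x a x' hxx',
      actionRel_beh_iff.2 ⟨hx', rfl⟩⟩
  · rintro ⟨hx, _, ⟨i, hi, rfl⟩, _, hR, hβ⟩
    obtain ⟨x', hxx', rfl⟩ := (beh_isMorphism M).back x a _ hR
    obtain ⟨hx', rfl⟩ := actionRel_beh_iff.1 hβ
    exact ⟨_, actionRel_beh_iff.2 ⟨hx, rfl⟩, (beh_isMorphism (M.update α)).forth
      ⟨(x, α.point), hx⟩ a ⟨(x', i), hx'⟩ ⟨hxx', hi⟩⟩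

theorem fDia_actionRel_fDia_R (α : Action Ag AtProp) (a : Ag)
    (U : Set (finalModel.{u, v, w} Ag AtProp).W) :
    fDia (actionRel α) (fDia ((finalModel Ag AtProp).R a) U) =
      α.pre.ext (finalModel Ag AtProp) ∩
        ⋃ (β) (_ : α.Sees a β), fDia ((finalModel Ag AtProp).R a) (fDia (actionRel β) U) := by
  ext z
  simp only [mem_inter_iff, mem_iUnion₂]
  constructor
  · rintro ⟨y, hzy, z', hyz', hU⟩
    obtain ⟨hz, β, hβ, y', hzy', hyz''⟩ := comp_actionRel_R_iff.1 ⟨y, hzy, hyz'⟩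
    exact ⟨hz, β, hβ, y', hzy', z', hyz'', hU⟩
  · rintro ⟨hz, β, hβ, y, hzy, z', hyz', hU⟩
    obtain ⟨y', hzy', hyz''⟩ := comp_actionRel_R_iff.2 ⟨hz, β, hβ, y, hzy, hyz'⟩
    exact ⟨y', hzy', z', hyz'', hU⟩

theorem fBox_actionRel_fBox_R (α : Action Ag AtProp) (a : Ag)
    (U : Set (finalModel.{u, v, w} Ag AtProp).W) :
    fBox (actionRel α) (fBox ((finalModel Ag AtProp).R a) U) =
      (α.pre.ext (finalModel Ag AtProp))ᶜ ∪
        ⋂ (β) (_ : α.Sees a β), fBox ((finalModel Ag AtProp).R a) (fBox (actionRel β) U) := by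
  simpa only [compl_inter, compl_iUnion₂, compl_fDia, compl_compl] using
    congrArg compl (fDia_actionRel_fDia_R α a Uᶜ)

theorem fDia_R_fDia_actionRel_subset {α β : Action Ag AtProp} {a : Ag} (h : α.Sees a β)
    (U : Set (finalModel.{u, v, w} Ag AtProp).W) :
    α.pre.ext (finalModel Ag AtProp) ∩ fDia ((finalModel Ag AtProp).R a) (fDia (actionRel β) U) ⊆
      fDia (actionRel α) (fDia ((finalModel Ag AtProp).R a) U) := by
  rw [fDia_actionRel_fDia_R]
  exact inter_subset_inter_right _ (subset_iUnion₂_of_subset β h subset_rfl)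

theorem fBox_actionRel_fBox_R_subset {α β : Action Ag AtProp} {a : Ag} (h : α.Sees a β)
    (U : Set (finalModel.{u, v, w} Ag AtProp).W) :
    fBox (actionRel α) (fBox ((finalModel Ag AtProp).R a) U) ⊆
      (α.pre.ext (finalModel Ag AtProp))ᶜ ∪
        fBox ((finalModel Ag AtProp).R a) (fBox (actionRel β) U) := by
  rw [fBox_actionRel_fBox_R]
  exact union_subset_union_right _ (iInter₂_subset β h)

end ActionRel

section Structures

variable {Ag : Type u} {AtProp : Type v} (post : Action Ag AtProp → Fm Ag AtProp)

theorem Action.finite_setOf_sees (α : Action Ag AtProp) (a : Ag) : {β | α.Sees a β}.Finite :=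
  (finite_range α.withPoint).subset fun _ ⟨i, _, h⟩ => ⟨i, h.symm⟩

theorem ext_toFm_semis (pos : Pos) (Y : Struct Ag AtProp) : ∀ {n : ℕ}, n ≠ 0 →
    Fm.ext.{u, v, w} ((semis Y n).toFm post pos) = Fm.ext.{u, v, w} (Y.toFm post pos)
  | 1, _ => by rw [semis]
  | n + 2, _ => by
    cases pos <;>
      simp only [semis, Struct.toFm, Fm.ext, ext_toFm_semis _ Y n.succ_ne_zero, inter_self,
        union_self]

theorem ext_toFm_semiSeen (pos : Pos) {α β : Action Ag AtProp} {a : Ag} (h : α.Sees a β)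
    (Y : Struct Ag AtProp) :
    Fm.ext.{u, v, w} ((semiSeen α a Y).toFm post pos) = Fm.ext.{u, v, w} (Y.toFm post pos) :=
  ext_toFm_semis post pos Y (ncard_ne_zero_of_mem h (α.finite_setOf_sees a))

theorem fDia_actionRel_fDia_R_subset_ext_toFm_semiSeen {α : Action Ag AtProp} {a : Ag}
    {Y : Struct Ag AtProp} {U : Set (finalModel.{u, v, w} Ag AtProp).W}
    (h : ∀ β, α.Sees a β →
      fDia ((finalModel Ag AtProp).R a) (fDia (actionRel β) U) ⊆ Fm.ext (Y.toFm post .succ)) :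
    fDia (actionRel α) (fDia ((finalModel Ag AtProp).R a) U) ⊆
      Fm.ext ((semiSeen α a Y).toFm post .succ) := by
  rw [fDia_actionRel_fDia_R]
  exact inter_subset_right.trans <| iUnion₂_subset fun β hβ =>
    (h β hβ).trans (ext_toFm_semiSeen post .succ hβ Y).ge

theorem ext_toFm_semiSeen_subset_fBox_actionRel_fBox_R {α : Action Ag AtProp} {a : Ag}
    {Y : Struct Ag AtProp} {U : Set (finalModel.{u, v, w} Ag AtProp).W}
    (h : ∀ β, α.Sees a β →
      Fm.ext (Y.toFm post .prec) ⊆ fBox ((finalModel Ag AtProp).R a) (fBox (actionRel β) U)) :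
    Fm.ext ((semiSeen α a Y).toFm post .prec) ⊆
      fBox (actionRel α) (fBox ((finalModel Ag AtProp).R a) U) := by
  rw [fBox_actionRel_fBox_R]
  exact subset_union_of_subset_right (subset_iInter₂ fun β hβ =>
    (ext_toFm_semiSeen post .prec hβ Y).le.trans (h β hβ)) _

theorem ext_toFm_prefixed_atom_subset (p : AtProp) : ∀ Γ : List (Step Ag AtProp),
    Fm.ext.{u, v, w} ((prefixed Γ (.fm (.atom p))).toFm post .prec) ⊆
      (finalModel.{u, v, w} Ag AtProp).V p
  | [] => subset_rfl
  | .fwd _ :: Γ => fun _ ⟨_, h, hz⟩ =>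
    (actionRel_mem_V_iff h p).2 (ext_toFm_prefixed_atom_subset p Γ hz)
  | .bwd _ :: Γ => fun _ ⟨_, h, hz⟩ =>
    (actionRel_mem_V_iff h p).1 (ext_toFm_prefixed_atom_subset p Γ hz)

theorem subset_ext_toFm_prefixed_atom (p : AtProp) : ∀ Δ : List (Step Ag AtProp),
    (finalModel.{u, v, w} Ag AtProp).V p ⊆
      Fm.ext.{u, v, w} ((prefixed Δ (.fm (.atom p))).toFm post .succ)
  | [] => subset_rfl
  | .fwd _ :: Δ => fun _ hz _ h =>
    subset_ext_toFm_prefixed_atom p Δ ((actionRel_mem_V_iff h p).1 hz)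
  | .bwd _ :: Δ => fun _ hz _ h =>
    subset_ext_toFm_prefixed_atom p Δ ((actionRel_mem_V_iff h p).2 hz)

end Structures

section Soundness

variable {Ag : Type u} {AtProp : Type v} (post : Action Ag AtProp → Fm Ag AtProp)

theorem Rule.sound {P : Set (Sequent Ag AtProp)} {s : Sequent Ag AtProp} (h : Rule P s)
    (hP : ∀ t ∈ P, Sequent.Holds.{u, v, w} post t) : Sequent.Holds.{u, v, w} post s := by
  cases h
  case atom Γ Δ p =>
    exact (ext_toFm_prefixed_atom_subset post p Γ).trans (subset_ext_toFm_prefixed_atom post p Δ)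
  all_goals
    simp only [mem_insert_iff, mem_singleton_iff, mem_empty_iff_false, mem_ofPred_eq,
      forall_eq_or_imp, forall_eq, forall_exists_index, and_imp,
      Sequent.Holds, Struct.toFm, Fm.ext] at hP ⊢
  case ag_agConv_down | act_actConv_down => exact (gc_fDia_pBox _ _ _).1 hP
  case ag_agConv_up | act_actConv_up => exact (gc_fDia_pBox _ _ _).2 hP
  case agConv_ag_down | actConv_act_down => exact (gc_pDia_fBox _ _ _).2 hP
  case agConv_ag_up | actConv_act_up => exact (gc_pDia_fBox _ _ _).1 hP
  -- Up to unfolding, `pDia R` and `pBox R` are `fDia (flip R)` and `fBox (flip R)`.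
  case agDiaR | agConvDiaR | actDiaR | actConvDiaR => exact fDia_mono hP
  case agBoxL | agConvBoxL | actBoxL | actConvBoxL => exact fBox_mono hP
  case ag_FSL | agConv_FSL | act_FSL | actConv_FSL => exact (fDia_sdiff_subset ..).trans hP
  case ag_FSR | agConv_FSR | act_FSR | actConv_FSR =>
    exact hP.trans (compl_fDia_union_fBox_subset ..)
  case ag_monL | agConv_monL | act_monL | actConv_monL => exact (fDia_inter_subset ..).trans hP
  case ag_monR | agConv_monR | act_monR | actConv_monR => exact hP.trans (fBox_union_subset ..)
  case balance => exact (fDia_subset_fBox (actionRel_rightUnique _) _).trans (fBox_mono hP)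
  case compL =>
    rw [← fDia_actionRel_univ]
    exact (fDia_univ_inter_subset_fDia_pDia ..).trans hP
  case compR =>
    rw [← fDia_actionRel_univ]
    exact hP.trans (fBox_pBox_subset ..)
  case reduceL => rwa [← fDia_actionRel_univ, fDia_univ_inter_fDia] at hP
  case reduceR => rwa [← fDia_actionRel_univ, compl_fDia_univ_union_fBox] at hP
  case swapInL hβ => exact (fDia_R_fDia_actionRel_subset hβ _).trans hP
  case swapInR hβ => exact hP.trans (fBox_actionRel_fBox_R_subset hβ _)
  case swapOutL =>
    exact fDia_actionRel_fDia_R_subset_ext_toFm_semiSeen post fun β hβ => hP _ β hβ rfl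
  case swapOutR =>
    exact ext_toFm_semiSeen_subset_fBox_actionRel_fBox_R post fun β hβ => hP _ β hβ rfl
  -- The remaining rules hold in every Boolean algebra, with diamonds and boxes read as atoms.
  all_goals
    simp only [subset_def, mem_union, mem_inter_iff, mem_sdiff, mem_compl_iff, mem_univ,
      mem_empty_iff_false] at hP ⊢
    grind

theorem Derivable.holds {s : Sequent Ag AtProp} (h : Derivable s) :
    Sequent.Holds.{u, v, w} post s := by
  induction h with
  | step hr _ ih => exact hr.sound post ih

end Soundness

end EAK

theorem mainTheorem3 {Ag : Type u} {AtProp : Type v}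
    (post : EAK.Action Ag AtProp → EAK.Fm Ag AtProp) :
    (∀ (P : Set (EAK.Sequent Ag AtProp)) (s : EAK.Sequent Ag AtProp), EAK.Rule P s →
      (∀ t ∈ P, EAK.Sequent.Holds.{u, v, w} post t) → EAK.Sequent.Holds.{u, v, w} post s) ∧
    (∀ s : EAK.Sequent Ag AtProp, EAK.Derivable s → EAK.Sequent.Holds.{u, v, w} post s) :=
  ⟨fun _ _ h => h.sound post, fun _ h => h.holds post⟩
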